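/- All chain complexes are non-negatively graded complexes of abelian groups. A chain operad is a (symmetric, unital) operad $\mathcal D=\{\mathcal D(n)\}_{n\ge 0}$ in the category of chain complexes, with compositions $\circ_k:\mathcal D(n)\otimes\mathcal D(j)\to\mathcal D(n+j-1)$. A filtered chain operad is a chain operad together with, for each $n$, an exhaustive increasing filtration $0=F_{-1}\mathcal D(n)\subseteq F_0\mathcal D(n)\subseteq F_1\mathcal D(n)\subseteq\cdots$ of $\mathcal D(n)$ by subcomplexes such that each $\circ_k$ takes $F_i\mathcal D(n)\times F_{i'}\mathcal D(j)$ into $F_{i+i'}\mathcal D(n+j-1)$, each $F_i\mathcal D(n)$ is invariant under the symmetric group $\Sigma_n$, and the identity element lies in $F_0\mathcal D(1)$. It is homologically filtered if $H_j(F_i\mathcal D(n)/F_{i-1}\mathcal D(n))=0$ for all $n$, $i$ and all $j\ne i$. The condensation $\overline{\mathcal D}$ of a homologically filtered chain operad is the chain operad whose $n$-th object is the chain complex with $i$-th group $H_i(F_i\mathcal D(n)/F_{i-1}\mathcal D(n))$ and with $i$-th boundary operator the boundary operator $H_i(F_i/F_{i-1})\to H_{i-1}(F_{i-1}/F_{i-2})$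 of the triple $(F_i\mathcal D(n),F_{i-1}\mathcal D(n),F_{i-2}\mathcal D(n))$, and whose operad structure is induced by that of $\mathcal D$ (so that $[x]\circ_k[y]=[x\circ_k y]$, $\sigma[x]=[\sigma x]$, and the identity element is $[\mathrm{id}]$). A quasi-isomorphism of chain operads is a morphism of chain operads that induces an isomorphism in homology in each arity. **Theorem.** Let $\mathcal D$ be a homologically filtered chain operad. Then $\mathcal D$ is quasi-isomorphic, in the category of chain operads, to its condensation $\overline{\mathcal D}$: there are a chain operad $\mathcal E$ and quasi-isomorphisms of chain operads $\mathcal E\to\mathcal D$ and $\mathcal E\to\overline{\mathcal D}$. -/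

import Mathlib

open CategoryTheory

universe u

noncomputable section

/-- A subcomplex of a chain complex of abelian groups. -/
structure SubChain (X : ChainComplex AddCommGrpCat.{u} ℕ) where
  carrier : ∀ a : ℕ, AddSubgroup (X.X a)
  d_mem : ∀ (a b : ℕ) (x : X.X a), x ∈ carrier a → X.d a b x ∈ carrier b

namespace SubChain

variable {X Y : ChainComplex AddCommGrpCat.{u} ℕ}

instance : LE (SubChain X) where
  le P Q := ∀ a, P.carrier a ≤ Q.carrier a

/-- The zero subcomplex. -/
def zero (X : ChainComplex AddCommGrpCat.{u} ℕ) : SubChain X where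
  carrier _ := ⊥
  d_mem a b x hx := by
    rw [AddSubgroup.mem_bot] at hx ⊢
    rw [hx, map_zero]

/-- The differential of `X` restricted to a subcomplex. -/
def dHom (P : SubChain X) (a b : ℕ) : P.carrier a →+ P.carrier b :=
  ((X.d a b).hom.comp (P.carrier a).subtype).codRestrict (P.carrier b)
    (fun x => P.d_mem a b x x.2)

/-- The quotient complex `P / (P ∩ Q)` of two subcomplexes of `X`; it is only used
for `Q ≤ P`, where it is `P / Q`. -/
def quot (P Q : SubChain X) : ChainComplex AddCommGrpCat.{u} ℕ where
  X a := AddCommGrpCat.of (P.carrier a ⧸ (Q.carrier a).addSubgroupOf (P.carrier a))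
  d a b := AddCommGrpCat.ofHom
    (QuotientAddGroup.map _ _ (P.dHom a b) (fun x hx => Q.d_mem a b x hx))
  shape a b h := by
    ext x
    · refine (QuotientAddGroup.eq_zero_iff _).2 ?_
      have : P.dHom a b x = 0 := Subtype.ext (by
        change X.d a b x.1 = 0
        rw [X.shape a b h]; rfl)
      rw [this]; exact zero_mem _
  d_comp_d' a b c _ _ := by
    ext x
    · refine (QuotientAddGroup.eq_zero_iff _).2 ?_
      have : P.dHom b c (P.dHom a b x) = 0 := Subtype.ext (by
        change X.d b c (X.d a b x.1) = 0
        rw [← ConcreteCategory.comp_apply, X.d_comp_d]; rfl)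
      rw [this]; exact zero_mem _

/-- The class in `P / Q` of an element of `P`. -/
def cl (P Q : SubChain X) (a : ℕ) : P.carrier a →+ (P.quot Q).X a :=
  QuotientAddGroup.mk' ((Q.carrier a).addSubgroupOf (P.carrier a))

lemma cl_surjective (P Q : SubChain X) (a : ℕ) : Function.Surjective (cl P Q a) :=
  QuotientAddGroup.mk'_surjective _

lemma cl_eq_zero_iff {P Q : SubChain X} {a : ℕ} (x : P.carrier a) :
    cl P Q a x = 0 ↔ (x : X.X a) ∈ Q.carrier a :=
  QuotientAddGroup.eq_zero_iff _

lemma d_cl (P Q : SubChain X) (a b : ℕ) (x : P.carrier a) :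
    (P.quot Q).d a b (cl P Q a x) = cl P Q b (P.dHom a b x) := rfl

/-- The map `P / Q ⟶ P' / Q'` induced by a chain map `f` with `f P ⊆ P'` and `f Q ⊆ Q'`. -/
def quotMap (f : X ⟶ Y) (P Q : SubChain X) (P' Q' : SubChain Y)
    (hP : ∀ a x, x ∈ P.carrier a → f.f a x ∈ P'.carrier a)
    (hQ : ∀ a x, x ∈ Q.carrier a → f.f a x ∈ Q'.carrier a) : P.quot Q ⟶ P'.quot Q' where
  f a := AddCommGrpCat.ofHom (QuotientAddGroup.map _ _
    (((f.f a).hom.comp (P.carrier a).subtype).codRestrict (P'.carrier a)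
      (fun x => hP a x x.2)) (fun x hx => hQ a x hx))
  comm' a b _ := by
    ext x
    · obtain ⟨x, rfl⟩ := cl_surjective P Q a x
      have h : P'.dHom a b ⟨f.f a x.1, hP a _ x.2⟩ =
          ⟨f.f b (X.d a b x.1), hP b _ (P.d_mem a b _ x.2)⟩ := Subtype.ext (by
        change Y.d a b (f.f a x.1) = f.f b (X.d a b x.1)
        rw [← ConcreteCategory.comp_apply, ← ConcreteCategory.comp_apply, f.comm])
      exact congrArg (cl P' Q' b) h

lemma quotMap_cl (f : X ⟶ Y) (P Q : SubChain X) (P' Q' : SubChain Y)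
    (hP : ∀ a x, x ∈ P.carrier a → f.f a x ∈ P'.carrier a)
    (hQ : ∀ a x, x ∈ Q.carrier a → f.f a x ∈ Q'.carrier a) (a : ℕ) (x : P.carrier a) :
    (quotMap f P Q P' Q' hP hQ).f a (cl P Q a x) = cl P' Q' a ⟨f.f a x, hP a x x.2⟩ := rfl

/-- For `R ≤ Q ≤ P`, the sequence `0 → Q / R → P / R → P / Q → 0` of the triple `(P, Q, R)`. -/
def triple (P Q R : SubChain X) (hQP : Q ≤ P) (hRQ : R ≤ Q) :
    ShortComplex (ChainComplex AddCommGrpCat.{u} ℕ) where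
  X₁ := Q.quot R
  X₂ := P.quot R
  X₃ := P.quot Q
  f := quotMap (𝟙 X) Q R P R (fun a _ hx => hQP a hx) (fun _ _ hx => hx)
  g := quotMap (𝟙 X) P R P Q (fun _ _ hx => hx) (fun a _ hx => hRQ a hx)
  zero := by
    ext a x
    induction x using QuotientAddGroup.induction_on with
    | H x => exact (QuotientAddGroup.eq_zero_iff _).2 x.2

lemma triple_shortExact (P Q R : SubChain X) (hQP : Q ≤ P) (hRQ : R ≤ Q) :
    (triple P Q R hQP hRQ).ShortExact := by
  refine HomologicalComplex.shortExact_of_degreewise_shortExact _ (fun a => ?_)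
  refine { exact := ?_, mono_f := ?_, epi_g := ?_ }
  · rw [ShortComplex.ab_exact_iff]
    intro x hx
    obtain ⟨x, rfl⟩ := cl_surjective P R a x
    have hx' : (x : X.X a) ∈ Q.carrier a := (cl_eq_zero_iff x).1 hx
    exact ⟨cl Q R a ⟨x, hx'⟩, rfl⟩
  · rw [AddCommGrpCat.mono_iff_injective, injective_iff_map_eq_zero]
    intro x hx
    obtain ⟨x, rfl⟩ := cl_surjective Q R a x
    exact (cl_eq_zero_iff x).2 ((cl_eq_zero_iff (P := P) (Q := R) (⟨x.1, hQP a x.2⟩)).1 hx)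
  · rw [AddCommGrpCat.epi_iff_surjective]
    intro x
    obtain ⟨x, rfl⟩ := cl_surjective P Q a x
    exact ⟨cl P R a x, rfl⟩

/-- The elements of `P` in degree `a` whose boundary lies in `Q`, that is,
the relative cycles of the pair `(P, Q)`. -/
def relCycles (P Q : SubChain X) (a : ℕ) : AddSubgroup (X.X a) where
  carrier := {x | x ∈ P.carrier a ∧ ∀ b, X.d a b x ∈ Q.carrier b}
  add_mem' {x y} hx hy := ⟨add_mem hx.1 hy.1, fun b => by
    rw [map_add]; exact add_mem (hx.2 b) (hy.2 b)⟩
  zero_mem' := ⟨zero_mem _, fun b => by rw [map_zero]; exact zero_mem _⟩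
  neg_mem' {x} hx := ⟨neg_mem hx.1, fun b => by rw [map_neg]; exact neg_mem (hx.2 b)⟩

/-- The inclusion of the relative cycles in `P`. -/
def relIncl (P Q : SubChain X) (a : ℕ) : relCycles P Q a →+ P.carrier a :=
  AddSubgroup.inclusion (fun _ hx => hx.1)

lemma iCycles_liftCycles_apply {K : ChainComplex AddCommGrpCat.{u} ℕ} {A : AddCommGrpCat.{u}}
    {i : ℕ} (k : A ⟶ K.X i) (j : ℕ) (hj : (ComplexShape.down ℕ).next i = j)
    (hk : k ≫ K.d i j = 0) (x : A) : K.iCycles i (K.liftCycles k j hj hk x) = k x := by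
  rw [← ConcreteCategory.comp_apply, HomologicalComplex.liftCycles_i]

lemma iCycles_injective (K : ChainComplex AddCommGrpCat.{u} ℕ) (i : ℕ) :
    Function.Injective (K.iCycles i) :=
  (AddCommGrpCat.mono_iff_injective (K.iCycles i)).1 inferInstance

/-- A relative cycle as a cycle of the quotient complex. -/
def toCycles (P Q : SubChain X) (a : ℕ) :
    AddCommGrpCat.of (relCycles P Q a) ⟶ (P.quot Q).cycles a :=
  (P.quot Q).liftCycles (AddCommGrpCat.ofHom ((cl P Q a).comp (relIncl P Q a))) _ rfl (by
    ext x
    exact (cl_eq_zero_iff _).2 (x.2.2 _))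

lemma iCycles_toCycles (P Q : SubChain X) (a : ℕ) (x : relCycles P Q a) :
    (P.quot Q).iCycles a (toCycles P Q a x) = cl P Q a (relIncl P Q a x) :=
  iCycles_liftCycles_apply _ _ _ _ _

/-- The homology class in `H_a (P / Q)` of a relative cycle. -/
def cls (P Q : SubChain X) (a : ℕ) : relCycles P Q a →+ (P.quot Q).homology a :=
  (toCycles P Q a ≫ (P.quot Q).homologyπ a).hom

lemma cls_surjective (P Q : SubChain X) (a : ℕ) : Function.Surjective (cls P Q a) := by
  intro h
  obtain ⟨z, rfl⟩ := (AddCommGrpCat.epi_iff_surjective ((P.quot Q).homologyπ a)).1 inferInstance h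
  obtain ⟨x, hx⟩ := cl_surjective P Q a ((P.quot Q).iCycles a z)
  have hd : ∀ b, X.d a b x.1 ∈ Q.carrier b := fun b => by
    have h1 : (P.quot Q).d a b (cl P Q a x) = 0 := by
      rw [hx, ← ConcreteCategory.comp_apply, HomologicalComplex.iCycles_d]; rfl
    exact (cl_eq_zero_iff (P.dHom a b x)).1 h1
  refine ⟨⟨x.1, x.2, hd⟩, congrArg ((P.quot Q).homologyπ a) ?_⟩
  exact iCycles_injective _ _ ((iCycles_toCycles _ _ _ _).trans hx)

lemma cls_eq_zero_iff (P Q : SubChain X) (a : ℕ) (x : relCycles P Q a) :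
    cls P Q a x = 0 ↔
      ∃ y ∈ P.carrier (a + 1), x.1 - X.d (a + 1) a y ∈ Q.carrier a := by
  have key : cls P Q a x = 0 ↔
      ∃ y : (P.quot Q).X (a + 1), (P.quot Q).toCycles (a + 1) a y = toCycles P Q a x := by
    have hS : (ShortComplex.mk _ _ ((P.quot Q).toCycles_comp_homologyπ (a + 1) a)).Exact :=
      ShortComplex.exact_of_g_is_cokernel _ ((P.quot Q).homologyIsCokernel (a + 1) a (by simp))
    constructor
    · intro h
      exact (ShortComplex.ab_exact_iff _).1 hS _ h
    · rintro ⟨y, hy⟩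
      change (P.quot Q).homologyπ a (toCycles P Q a x) = 0
      rw [← hy, ← ConcreteCategory.comp_apply, HomologicalComplex.toCycles_comp_homologyπ]; rfl
  have inj := iCycles_injective (P.quot Q) a
  have e : ∀ y, (P.quot Q).iCycles a ((P.quot Q).toCycles (a + 1) a y) =
      (P.quot Q).d (a + 1) a y := fun y => by
    rw [← ConcreteCategory.comp_apply, HomologicalComplex.toCycles_i]
  rw [key]
  constructor
  · rintro ⟨y, hy⟩
    obtain ⟨y, rfl⟩ := cl_surjective P Q _ y
    refine ⟨y.1, y.2, ?_⟩
    have h1 := congrArg ((P.quot Q).iCycles a) hy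
    rw [e, iCycles_toCycles, d_cl, eq_comm, ← sub_eq_zero, ← map_sub] at h1
    exact (cl_eq_zero_iff _).1 h1
  · rintro ⟨y, hy, hxy⟩
    refine ⟨cl P Q _ ⟨y, hy⟩, inj ?_⟩
    rw [e, iCycles_toCycles, d_cl, eq_comm, ← sub_eq_zero, ← map_sub]
    exact (cl_eq_zero_iff _).2 hxy

/-- The boundary operator `H_{a+1} (P / Q) → H_a (Q / R)` of the triple `(P, Q, R)`. -/
def tripleBoundary (P Q R : SubChain X) (hQP : Q ≤ P) (hRQ : R ≤ Q) (a : ℕ) :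
    (P.quot Q).homology (a + 1) ⟶ (Q.quot R).homology a :=
  (triple_shortExact P Q R hQP hRQ).δ (a + 1) a (by simp)

lemma d_mem_relCycles {P Q R : SubChain X} {a b : ℕ} {x : X.X a} (hx : x ∈ relCycles P Q a) :
    X.d a b x ∈ relCycles Q R b :=
  ⟨hx.2 b, fun c => by
    rw [← ConcreteCategory.comp_apply, X.d_comp_d]; exact zero_mem (R.carrier c)⟩

/-- The differential from the relative cycles of `(P, Q)` to `Q`. -/
def relD (P Q : SubChain X) (a b : ℕ) : relCycles P Q a →+ Q.carrier b :=
  ((X.d a b).hom.comp (relCycles P Q a).subtype).codRestrict (Q.carrier b) (fun x => x.2.2 b)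

lemma tripleBoundary_cls (P Q R : SubChain X) (hQP : Q ≤ P) (hRQ : R ≤ Q) (a : ℕ)
    (x : relCycles P Q (a + 1)) :
    tripleBoundary P Q R hQP hRQ a (cls P Q (a + 1) x) =
      cls Q R a ⟨X.d (a + 1) a x.1, d_mem_relCycles x.2⟩ := by
  have h := (triple_shortExact P Q R hQP hRQ).δ_eq (a + 1) a (by simp)
    (AddCommGrpCat.ofHom ((cl P Q (a + 1)).comp (relIncl P Q (a + 1))))
    (by ext x; exact (cl_eq_zero_iff _).2 (x.2.2 a))
    (AddCommGrpCat.ofHom ((cl P R (a + 1)).comp (relIncl P Q (a + 1)))) rfl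
    (AddCommGrpCat.ofHom ((cl Q R a).comp (relD P Q (a + 1) a))) rfl _ rfl
  refine Eq.trans ?_ ((ConcreteCategory.congr_hom h x).trans ?_)
  · refine congrArg (tripleBoundary P Q R hQP hRQ a)
      (congrArg ((P.quot Q).homologyπ (a + 1)) ?_)
    rfl
  · refine congrArg ((Q.quot R).homologyπ a) ?_
    apply iCycles_injective (Q.quot R) a
    exact (iCycles_liftCycles_apply _ _ _ _ _).trans
      (iCycles_toCycles Q R a ⟨_, d_mem_relCycles x.2⟩).symm

lemma homologyMap_quotMap_cls (f : X ⟶ Y) (P Q : SubChain X) (P' Q' : SubChain Y)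
    (hP : ∀ a x, x ∈ P.carrier a → f.f a x ∈ P'.carrier a)
    (hQ : ∀ a x, x ∈ Q.carrier a → f.f a x ∈ Q'.carrier a) (a : ℕ) (x : relCycles P Q a) :
    HomologicalComplex.homologyMap (quotMap f P Q P' Q' hP hQ) a (cls P Q a x) =
      cls P' Q' a ⟨f.f a x.1, hP a _ x.2.1, fun b => by
        rw [← ConcreteCategory.comp_apply, f.comm, ConcreteCategory.comp_apply]
        exact hQ b _ (x.2.2 b)⟩ := by
  change HomologicalComplex.homologyMap (quotMap f P Q P' Q' hP hQ) a
    ((P.quot Q).homologyπ a (toCycles P Q a x)) = _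
  rw [← ConcreteCategory.comp_apply, HomologicalComplex.homologyπ_naturality,
    ConcreteCategory.comp_apply]
  refine congrArg ((P'.quot Q').homologyπ a) ?_
  apply iCycles_injective (P'.quot Q') a
  refine Eq.trans ?_ (iCycles_toCycles P' Q' a _).symm
  rw [← ConcreteCategory.comp_apply, HomologicalComplex.cyclesMap_i, ConcreteCategory.comp_apply,
    iCycles_toCycles]
  rfl

end SubChain

/-- An exhaustive increasing filtration `0 = F₋₁ ⊆ F₀ ⊆ F₁ ⊆ ⋯` of a chain complex
by subcomplexes. -/
structure ChainFiltration (X : ChainComplex AddCommGrpCat.{u} ℕ) where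
  step : ℕ → SubChain X
  mono : ∀ i, step i ≤ step (i + 1)
  exhaustive : ∀ (a : ℕ) (x : X.X a), ∃ i, x ∈ (step i).carrier a

namespace ChainFiltration

open SubChain

variable {X Y : ChainComplex AddCommGrpCat.{u} ℕ} (F : ChainFiltration X) (G : ChainFiltration Y)

/-- The subcomplex `F_{i-1}`, where `F_{-1} = 0`. -/
def pred : ℕ → SubChain X
  | 0 => SubChain.zero X
  | i + 1 => F.step i

lemma pred_le (i : ℕ) : F.pred i ≤ F.step i := by
  cases i with
  | zero =>
    intro a x hx
    rw [(AddSubgroup.mem_bot.1 hx : x = 0)]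
    exact zero_mem _
  | succ i => exact F.mono i

/-- The quotient complex `F_i / F_{i-1}`. -/
def gr (i : ℕ) : ChainComplex AddCommGrpCat.{u} ℕ := (F.step i).quot (F.pred i)

/-- The homology of `F_i / F_{i-1}` is concentrated in dimension `i`. -/
def IsHomological : Prop :=
  ∀ i j : ℕ, j ≠ i → Limits.IsZero ((F.gr i).homology j)

/-- The boundary operator `H_{i+1} (F_{i+1} / F_i) → H_i (F_i / F_{i-1})`
of the triple `(F_{i+1}, F_i, F_{i-1})`. -/
def boundary (i : ℕ) : (F.gr (i + 1)).homology (i + 1) ⟶ (F.gr i).homology i :=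
  tripleBoundary (F.step (i + 1)) (F.step i) (F.pred i) (F.mono i) (F.pred_le i) i

lemma boundary_comp_boundary (i : ℕ) : F.boundary (i + 1) ≫ F.boundary i = 0 := by
  ext z
  obtain ⟨x, rfl⟩ := cls_surjective (F.step (i + 2)) (F.pred (i + 2)) (i + 2) z
  refine (congrArg (F.boundary i) (tripleBoundary_cls _ _ _ _ _ (i + 1) x)).trans ?_
  refine (tripleBoundary_cls (F.step (i + 1)) (F.step i) (F.pred i) _ _ i _).trans ?_
  refine Eq.trans ?_ (map_zero (cls (F.step i) (F.pred i) i))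
  refine congrArg (cls (F.step i) (F.pred i) i) (Subtype.ext ?_)
  change X.d (i + 1) i (X.d (i + 2) (i + 1) x.1) = 0
  rw [← ConcreteCategory.comp_apply, X.d_comp_d]; rfl

/-- The condensation: the chain complex with `i`-th group `H_i (F_i / F_{i-1})` and
the boundary operators of the triples `(F_i, F_{i-1}, F_{i-2})`. -/
def condensation : ChainComplex AddCommGrpCat.{u} ℕ :=
  ChainComplex.of (fun i => (F.gr i).homology i) F.boundary F.boundary_comp_boundary

/-- The chains `x ∈ F_a X_a` with `d x ∈ F_{a-1}`. -/
def rel (a : ℕ) : AddSubgroup (X.X a) := relCycles (F.step a) (F.pred a) a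

/-- The class in `H_a (F_a / F_{a-1})` of `x ∈ F_a X_a` with `d x ∈ F_{a-1}`. -/
def cls (a : ℕ) : F.rel a →+ F.condensation.X a :=
  SubChain.cls (F.step a) (F.pred a) a

lemma cls_surjective (a : ℕ) : Function.Surjective (F.cls a) :=
  SubChain.cls_surjective (F.step a) (F.pred a) a

lemma cls_eq_zero_iff (a : ℕ) (x : F.rel a) :
    F.cls a x = 0 ↔
      ∃ y ∈ (F.step a).carrier (a + 1), x.1 - X.d (a + 1) a y ∈ (F.pred a).carrier a :=
  SubChain.cls_eq_zero_iff (F.step a) (F.pred a) a x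

lemma d_mem_rel {a b : ℕ} {x : X.X a} (hx : x ∈ F.rel a) : X.d a b x ∈ F.rel b := by
  by_cases h : b + 1 = a
  · subst h
    exact d_mem_relCycles hx
  · rw [X.shape a b h]
    exact zero_mem _

lemma d_cls (a b : ℕ) (x : F.rel a) :
    F.condensation.d a b (F.cls a x) = F.cls b ⟨X.d a b x.1, F.d_mem_rel x.2⟩ := by
  by_cases h : b + 1 = a
  · subst h
    have e : F.condensation.d (b + 1) b = F.boundary b :=
      ChainComplex.of_d (fun i => (F.gr i).homology i) F.boundary b
    rw [e]
    exact tripleBoundary_cls (F.step (b + 1)) (F.step b) (F.pred b) _ _ b x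
  · rw [F.condensation.shape a b h]
    refine (map_zero (F.cls b)).symm.trans (congrArg (F.cls b) (Subtype.ext ?_))
    change 0 = X.d a b x.1
    rw [X.shape a b h]; rfl

variable {F G}

lemma map_mem_pred (f : X ⟶ Y)
    (hf : ∀ i a x, x ∈ (F.step i).carrier a → f.f a x ∈ (G.step i).carrier a)
    (i a : ℕ) (x : X.X a) (hx : x ∈ (F.pred i).carrier a) : f.f a x ∈ (G.pred i).carrier a := by
  cases i with
  | zero =>
    rw [(AddSubgroup.mem_bot.1 hx : x = 0), map_zero]
    exact zero_mem _
  | succ i => exact hf i a x hx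

lemma map_mem_rel (f : X ⟶ Y)
    (hf : ∀ i a x, x ∈ (F.step i).carrier a → f.f a x ∈ (G.step i).carrier a)
    {a : ℕ} {x : X.X a} (hx : x ∈ F.rel a) : f.f a x ∈ G.rel a :=
  ⟨hf a a x hx.1, fun b => by
    rw [← ConcreteCategory.comp_apply, f.comm, ConcreteCategory.comp_apply]
    exact map_mem_pred f hf a b _ (hx.2 b)⟩

/-- The map `H_i (F_i X / F_{i-1} X) → H_i (F_i Y / F_{i-1} Y)` induced by a filtered map. -/
def grMap (f : X ⟶ Y)
    (hf : ∀ i a x, x ∈ (F.step i).carrier a → f.f a x ∈ (G.step i).carrier a) (i : ℕ) :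
    F.condensation.X i ⟶ G.condensation.X i :=
  HomologicalComplex.homologyMap
    (quotMap f (F.step i) (F.pred i) (G.step i) (G.pred i) (hf i) (map_mem_pred f hf i)) i

lemma grMap_cls (f : X ⟶ Y)
    (hf : ∀ i a x, x ∈ (F.step i).carrier a → f.f a x ∈ (G.step i).carrier a) (a : ℕ)
    (x : F.rel a) : grMap f hf a (F.cls a x) = G.cls a ⟨f.f a x.1, map_mem_rel f hf x.2⟩ :=
  homologyMap_quotMap_cls f (F.step a) (F.pred a) (G.step a) (G.pred a) _ _ a x

/-- The map of condensations induced by a filtered map. -/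
def condensationMap (f : X ⟶ Y)
    (hf : ∀ i a x, x ∈ (F.step i).carrier a → f.f a x ∈ (G.step i).carrier a) :
    F.condensation ⟶ G.condensation where
  f i := grMap f hf i
  comm' a b _ := by
    ext z
    obtain ⟨x, rfl⟩ := F.cls_surjective a z
    change G.condensation.d a b (grMap f hf a (F.cls a x)) =
      grMap f hf b (F.condensation.d a b (F.cls a x))
    rw [grMap_cls, d_cls, d_cls, grMap_cls]
    refine congrArg (G.cls b) (Subtype.ext ?_)
    change Y.d a b (f.f a x.1) = f.f b (X.d a b x.1)
    rw [← ConcreteCategory.comp_apply, ← ConcreteCategory.comp_apply, f.comm]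

lemma condensationMap_cls (f : X ⟶ Y)
    (hf : ∀ i a x, x ∈ (F.step i).carrier a → f.f a x ∈ (G.step i).carrier a) (a : ℕ)
    (x : F.rel a) :
    (condensationMap f hf).f a (F.cls a x) = G.cls a ⟨f.f a x.1, map_mem_rel f hf x.2⟩ :=
  grMap_cls f hf a x

end ChainFiltration

/-- In a composition `x ∘_k y` with `x` of arity `n` and `y` of arity `m`, input `j` of `y`
becomes input `k + j` (everything numbered from `0`). -/
def innerSlot {n m p : ℕ} (h : p + 1 = n + m) (k : Fin n) (j : Fin m) : Fin p :=
  ⟨k + j, by omega⟩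

/-- In a composition `x ∘_k y` with `x` of arity `n` and `y` of arity `m`, input `i ≠ k` of `x`
becomes input `i` if `i < k` and input `i + m - 1` if `i > k` (everything numbered from `0`). -/
def outerSlot {n m p : ℕ} (h : p + 1 = n + m) (k i : Fin n) (hi : i ≠ k) : Fin p :=
  ⟨if i < k then i else i + m - 1, by
    have : (i : ℕ) ≠ k := fun e => hi (Fin.ext e)
    split <;> rename_i h' <;> rw [Fin.lt_def] at h' <;> omega⟩

/-- `ρ` is the permutation `σ ∘_k τ` of the inputs of `x ∘_k y` that is induced by the
permutations `σ` of the inputs of `x` and `τ` of the inputs of `y`. -/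
def IsBlockPerm {n m p : ℕ} (h : p + 1 = n + m) (k : Fin n) (σ : Equiv.Perm (Fin n))
    (τ : Equiv.Perm (Fin m)) (ρ : Equiv.Perm (Fin p)) : Prop :=
  (∀ (i : Fin n) (hi : i ≠ k),
    ρ (outerSlot h k i hi) = outerSlot h (σ k) (σ i) (fun e => hi (σ.injective e))) ∧
  ∀ j : Fin m, ρ (innerSlot h k j) = innerSlot h (σ k) (τ j)

lemma slot_cases {n m p : ℕ} (h : p + 1 = n + m) (k : Fin n) (s : Fin p) :
    (∃ i hi, s = outerSlot h k i hi) ∨ ∃ j, s = innerSlot h k j := by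
  by_cases h1 : s.1 < k.1
  · refine Or.inl ⟨⟨s, by omega⟩, fun e => ?_, Fin.ext ?_⟩
    · rw [← e] at h1; exact lt_irrefl _ h1
    · simp [outerSlot, Fin.lt_def, h1]
  · by_cases h2 : s.1 < k.1 + m
    · exact Or.inr ⟨⟨s - k, by omega⟩, Fin.ext (by simp [innerSlot]; omega)⟩
    · refine Or.inl ⟨⟨s + 1 - m, by omega⟩, fun e => ?_, Fin.ext ?_⟩
      · have := congrArg Fin.val e; simp at this; omega
      · simp only [outerSlot, Fin.lt_def]; split <;> omega

lemma innerSlot_injective {n m p : ℕ} (h : p + 1 = n + m) (k : Fin n) (j j' : Fin m)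
    (e : innerSlot h k j = innerSlot h k j') : j = j' := by
  have := congrArg Fin.val e
  simp only [innerSlot] at this
  exact Fin.ext (by omega)

lemma outerSlot_injective {n m p : ℕ} (h : p + 1 = n + m) (k i i' : Fin n) (hi : i ≠ k)
    (hi' : i' ≠ k) (e : outerSlot h k i hi = outerSlot h k i' hi') : i = i' := by
  have := congrArg Fin.val e
  have h1 : (i : ℕ) ≠ k := fun e => hi (Fin.ext e)
  have h2 : (i' : ℕ) ≠ k := fun e => hi' (Fin.ext e)
  simp only [outerSlot, Fin.lt_def] at this
  refine Fin.ext ?_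
  split at this <;> split at this <;> omega

lemma outerSlot_ne_innerSlot {n m p : ℕ} (h : p + 1 = n + m) (k i : Fin n) (hi : i ≠ k)
    (j : Fin m) : outerSlot h k i hi ≠ innerSlot h k j := by
  intro e
  have := congrArg Fin.val e
  have h1 : (i : ℕ) ≠ k := fun e => hi (Fin.ext e)
  simp only [outerSlot, innerSlot, Fin.lt_def] at this
  split at this <;> omega

/-- The permutation `σ ∘_k τ` exists and is unique. -/
lemma existsUnique_isBlockPerm {n m p : ℕ} (h : p + 1 = n + m) (k : Fin n)
    (σ : Equiv.Perm (Fin n)) (τ : Equiv.Perm (Fin m)) :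
    ∃! ρ : Equiv.Perm (Fin p), IsBlockPerm h k σ τ ρ := by
  have hex : ∀ s : Fin p, ∃ t : Fin p,
      (∀ i hi, s = outerSlot h k i hi →
        t = outerSlot h (σ k) (σ i) (fun e => hi (σ.injective e))) ∧
      ∀ j, s = innerSlot h k j → t = innerSlot h (σ k) (τ j) := by
    intro s
    rcases slot_cases h k s with ⟨i, hi, rfl⟩ | ⟨j, rfl⟩
    · refine ⟨outerSlot h (σ k) (σ i) (fun e => hi (σ.injective e)), fun i' hi' e => ?_,
        fun j e => absurd e (outerSlot_ne_innerSlot _ _ _ _ _)⟩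
      obtain rfl := outerSlot_injective _ _ _ _ _ _ e; rfl
    · refine ⟨innerSlot h (σ k) (τ j),
        fun i hi e => absurd e.symm (outerSlot_ne_innerSlot _ _ _ _ _), fun j' e => ?_⟩
      obtain rfl := innerSlot_injective _ _ _ _ e; rfl
  choose f hf1 hf2 using hex
  have hinj : Function.Injective f := by
    intro s s' e
    rcases slot_cases h k s with ⟨i, hi, rfl⟩ | ⟨j, rfl⟩ <;>
      rcases slot_cases h k s' with ⟨i', hi', rfl⟩ | ⟨j', rfl⟩
    · rw [hf1 _ i hi rfl, hf1 _ i' hi' rfl] at e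
      obtain rfl := σ.injective (outerSlot_injective _ _ _ _ _ _ e); rfl
    · rw [hf1 _ i hi rfl, hf2 _ j' rfl] at e
      exact absurd e (outerSlot_ne_innerSlot _ _ _ _ _)
    · rw [hf2 _ j rfl, hf1 _ i' hi' rfl] at e
      exact absurd e.symm (outerSlot_ne_innerSlot _ _ _ _ _)
    · rw [hf2 _ j rfl, hf2 _ j' rfl] at e
      obtain rfl := τ.injective (innerSlot_injective _ _ _ _ e); rfl
  refine ⟨Equiv.ofBijective f (Finite.injective_iff_bijective.1 hinj),
    ⟨fun i hi => hf1 _ i hi rfl, fun j => hf2 _ j rfl⟩, fun ρ hρ => Equiv.ext fun s => ?_⟩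
  rcases slot_cases h k s with ⟨i, hi, rfl⟩ | ⟨j, rfl⟩
  · exact (hρ.1 i hi).trans (hf1 _ i hi rfl).symm
  · exact (hρ.2 j).trans (hf2 _ j rfl).symm

/-- A (symmetric, unital) operad in the category of non-negatively graded chain complexes of
abelian groups. The structure is given by left actions of the symmetric groups, an identity
element, and the compositions `∘_k : D(n) ⊗ D(m) ⟶ D(n + m - 1)`, which are written as
biadditive maps `D(n)_a × D(m)_b → D(p)_c` for `p + 1 = n + m` and `a + b = c`;
inputs are numbered from `0`. -/
structure ChainOperad where
  obj : ℕ → ChainComplex AddCommGrpCat.{u} ℕ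
  act (n : ℕ) (σ : Equiv.Perm (Fin n)) : obj n ⟶ obj n
  act_one (n : ℕ) : act n 1 = 𝟙 (obj n)
  act_mul (n : ℕ) (σ τ : Equiv.Perm (Fin n)) : act n (σ * τ) = act n τ ≫ act n σ
  one : (obj 1).X 0
  comp {n m p : ℕ} (h : p + 1 = n + m) (k : Fin n) {a b c : ℕ} (hd : a + b = c) :
    (obj n).X a →+ (obj m).X b →+ (obj p).X c
  -- the three cases of `d (x ∘_k y) = d x ∘_k y + (-1) ^ |x| x ∘_k d y`
  d_comp {n m p : ℕ} (h : p + 1 = n + m) (k : Fin n) {a b c : ℕ} (hd : a + 1 + (b + 1) = c + 1)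
    (x : (obj n).X (a + 1)) (y : (obj m).X (b + 1)) :
    (obj p).d (c + 1) c (comp h k hd x y) =
      comp h k (by omega) ((obj n).d (a + 1) a x) y +
        (-1 : ℤ) ^ (a + 1) • comp h k (by omega) x ((obj m).d (b + 1) b y)
  d_comp_zero_left {n m p : ℕ} (h : p + 1 = n + m) (k : Fin n) {b c : ℕ}
    (hd : 0 + (b + 1) = c + 1) (x : (obj n).X 0) (y : (obj m).X (b + 1)) :
    (obj p).d (c + 1) c (comp h k hd x y) = comp h k (by omega) x ((obj m).d (b + 1) b y)
  d_comp_zero_right {n m p : ℕ} (h : p + 1 = n + m) (k : Fin n) {a c : ℕ}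
    (hd : a + 1 + 0 = c + 1) (x : (obj n).X (a + 1)) (y : (obj m).X 0) :
    (obj p).d (c + 1) c (comp h k hd x y) = comp h k (by omega) ((obj n).d (a + 1) a x) y
  one_comp {m : ℕ} (h : m + 1 = 1 + m) {b : ℕ} (hd : 0 + b = b) (y : (obj m).X b) :
    comp h 0 hd one y = y
  comp_one {n : ℕ} (h : n + 1 = n + 1) (k : Fin n) {a : ℕ} (hd : a + 0 = a) (x : (obj n).X a) :
    comp h k hd x one = x
  -- `(x ∘_i y) ∘_{i + j} z = x ∘_i (y ∘_j z)`
  assoc {n m l p q r : ℕ} (h₁ : p + 1 = n + m) (h₂ : q + 1 = p + l) (h₃ : r + 1 = m + l)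
    (h₄ : q + 1 = n + r) (i : Fin n) (j : Fin m) {a b c ab bc abc : ℕ} (hab : a + b = ab)
    (hbc : b + c = bc) (habc : ab + c = abc) (habc' : a + bc = abc)
    (x : (obj n).X a) (y : (obj m).X b) (z : (obj l).X c) :
    comp h₂ (innerSlot h₁ i j) habc (comp h₁ i hab x y) z =
      comp h₄ i habc' x (comp h₃ j hbc y z)
  -- `(x ∘_i y) ∘_k z = (-1) ^ (|y| |z|) (x ∘_k z) ∘_i y` for distinct inputs `i`, `k` of `x`
  assoc_parallel {n m l p q r : ℕ} (h₁ : p + 1 = n + m) (h₂ : q + 1 = p + l) (h₃ : r + 1 = n + l)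
    (h₄ : q + 1 = r + m) (i k : Fin n) (hik : i ≠ k) {a b c ab ac abc : ℕ} (hab : a + b = ab)
    (hac : a + c = ac) (habc : ab + c = abc) (hacb : ac + b = abc)
    (x : (obj n).X a) (y : (obj m).X b) (z : (obj l).X c) :
    comp h₂ (outerSlot h₁ i k hik.symm) habc (comp h₁ i hab x y) z =
      (-1 : ℤ) ^ (b * c) • comp h₄ (outerSlot h₃ k i hik) hacb (comp h₃ k hac x z) y
  -- `(σ x) ∘_{σ(k)} (τ y) = (σ ∘_k τ) (x ∘_k y)`
  act_comp {n m p : ℕ} (h : p + 1 = n + m) (k : Fin n) {a b c : ℕ} (hd : a + b = c)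
    (σ : Equiv.Perm (Fin n)) (τ : Equiv.Perm (Fin m)) (ρ : Equiv.Perm (Fin p))
    (hρ : IsBlockPerm h k σ τ ρ) (x : (obj n).X a) (y : (obj m).X b) :
    comp h (σ k) hd ((act n σ).f a x) ((act m τ).f b y) = (act p ρ).f c (comp h k hd x y)

namespace ChainOperad

/-- A morphism of chain operads. -/
structure Hom (D E : ChainOperad.{u}) where
  map (n : ℕ) : D.obj n ⟶ E.obj n
  map_act (n : ℕ) (σ : Equiv.Perm (Fin n)) : D.act n σ ≫ map n = map n ≫ E.act n σ
  map_one : (map 1).f 0 D.one = E.one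
  map_comp {n m p : ℕ} (h : p + 1 = n + m) (k : Fin n) {a b c : ℕ} (hd : a + b = c)
    (x : (D.obj n).X a) (y : (D.obj m).X b) :
    (map p).f c (D.comp h k hd x y) = E.comp h k hd ((map n).f a x) ((map m).f b y)

/-- A morphism of chain operads is a quasi-isomorphism if it induces an isomorphism in homology
in each arity. -/
def Hom.IsQuasiIso {D E : ChainOperad.{u}} (f : Hom D E) : Prop :=
  ∀ n, QuasiIso (f.map n)

/-- Two chain operads are quasi-isomorphic if there is a third chain operad that maps to each
of them by a quasi-isomorphism of chain operads. -/
def QuasiIsomorphic (D E : ChainOperad.{u}) : Prop :=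
  ∃ (C : ChainOperad.{u}) (f : Hom C D) (g : Hom C E), f.IsQuasiIso ∧ g.IsQuasiIso

lemma d_comp_mem (D : ChainOperad.{u}) {n m p : ℕ} (h : p + 1 = n + m) (k : Fin n)
    {a b c e : ℕ} (hd : a + b = c) (x : (D.obj n).X a) (y : (D.obj m).X b)
    (S : AddSubgroup ((D.obj p).X e))
    (h₁ : ∀ (a' : ℕ) (hd' : a' + b = e), D.comp h k hd' ((D.obj n).d a a' x) y ∈ S)
    (h₂ : ∀ (b' : ℕ) (hd' : a + b' = e), D.comp h k hd' x ((D.obj m).d b b' y) ∈ S) :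
    (D.obj p).d c e (D.comp h k hd x y) ∈ S := by
  by_cases he : e + 1 = c
  · subst he
    rcases a with _ | a <;> rcases b with _ | b
    · omega
    · rw [D.d_comp_zero_left]; exact h₂ _ _
    · rw [D.d_comp_zero_right]; exact h₁ _ _
    · rw [D.d_comp]; exact add_mem (h₁ _ _) (zsmul_mem (h₂ _ _) _)
  · rw [(D.obj p).shape c e he]; exact zero_mem _

end ChainOperad

/-- A filtered chain operad: each `D(n)` is filtered, and the operad structure maps (symmetric
group actions, identity element, compositions) preserve filtrations. -/
structure FilteredChainOperad extends ChainOperad.{u} where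
  filt (n : ℕ) : ChainFiltration (obj n)
  act_mem (n : ℕ) (σ : Equiv.Perm (Fin n)) (i a : ℕ) (x : (obj n).X a)
    (hx : x ∈ ((filt n).step i).carrier a) : (act n σ).f a x ∈ ((filt n).step i).carrier a
  one_mem : one ∈ ((filt 1).step 0).carrier 0
  comp_mem {n m p : ℕ} (h : p + 1 = n + m) (k : Fin n) {a b c : ℕ} (hd : a + b = c) (i j : ℕ)
    (x : (obj n).X a) (y : (obj m).X b) (hx : x ∈ ((filt n).step i).carrier a)
    (hy : y ∈ ((filt m).step j).carrier b) :
    comp h k hd x y ∈ ((filt p).step (i + j)).carrier c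

/-- The biadditive map induced on quotients by a biadditive map. -/
def liftBiadd {A A' B B' C : Type*} [AddCommGroup A] [AddCommGroup A'] [AddCommGroup B]
    [AddCommGroup B'] [AddCommGroup C] (f : A →+ A') (hf : Function.Surjective f)
    (g : B →+ B') (hg : Function.Surjective g) (φ : A →+ B →+ C)
    (hφ₁ : ∀ x, f x = 0 → ∀ y, φ x y = 0) (hφ₂ : ∀ y, g y = 0 → ∀ x, φ x y = 0) :
    A' →+ B' →+ C :=
  f.liftOfSurjective hf ⟨AddMonoidHom.flip (g.liftOfSurjective hg ⟨φ.flip, fun y hy =>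
    AddMonoidHom.ext fun x => hφ₂ y hy x⟩), fun x hx => AddMonoidHom.ext fun z => by
      obtain ⟨y, rfl⟩ := hg z
      have e := AddMonoidHom.liftOfRightInverse_comp_apply g (Function.surjInv hg)
        (Function.rightInverse_surjInv hg)
        ⟨φ.flip, fun y hy => AddMonoidHom.ext fun x => hφ₂ y hy x⟩ y
      exact (DFunLike.congr_fun e x).trans (hφ₁ x hx y)⟩

lemma liftBiadd_apply {A A' B B' C : Type*} [AddCommGroup A] [AddCommGroup A'] [AddCommGroup B]
    [AddCommGroup B'] [AddCommGroup C] (f : A →+ A') (hf : Function.Surjective f)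
    (g : B →+ B') (hg : Function.Surjective g) (φ : A →+ B →+ C)
    (hφ₁ : ∀ x, f x = 0 → ∀ y, φ x y = 0) (hφ₂ : ∀ y, g y = 0 → ∀ x, φ x y = 0) (x : A) (y : B) :
    liftBiadd f hf g hg φ hφ₁ hφ₂ (f x) (g y) = φ x y :=
  (DFunLike.congr_fun (AddMonoidHom.liftOfRightInverse_comp_apply f (Function.surjInv hf)
    (Function.rightInverse_surjInv hf) _ x) (g y)).trans
    (DFunLike.congr_fun (AddMonoidHom.liftOfRightInverse_comp_apply g (Function.surjInv hg)
      (Function.rightInverse_surjInv hg)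
      ⟨φ.flip, fun y hy => AddMonoidHom.ext fun x => hφ₂ y hy x⟩ y) x)

namespace FilteredChainOperad

variable (D : FilteredChainOperad.{u})

/-- The filtration of each `D(n)` is homological. -/
def IsHomological : Prop := ∀ n, (D.filt n).IsHomological

lemma comp_mem_pred_left {n m p : ℕ} (h : p + 1 = n + m) (k : Fin n) {a b c : ℕ}
    (hd : a + b = c) {i j l : ℕ} (hl : i + j = l) {x : (D.obj n).X a} {y : (D.obj m).X b}
    (hx : x ∈ ((D.filt n).pred i).carrier a) (hy : y ∈ ((D.filt m).step j).carrier b) :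
    D.comp h k hd x y ∈ ((D.filt p).pred l).carrier c := by
  cases i with
  | zero =>
    rw [(AddSubgroup.mem_bot.1 hx : x = 0), map_zero]
    exact zero_mem _
  | succ i =>
    obtain rfl : i + j + 1 = l := by omega
    exact D.comp_mem h k hd i j x y hx hy

lemma comp_mem_pred_right {n m p : ℕ} (h : p + 1 = n + m) (k : Fin n) {a b c : ℕ}
    (hd : a + b = c) {i j l : ℕ} (hl : i + j = l) {x : (D.obj n).X a} {y : (D.obj m).X b}
    (hx : x ∈ ((D.filt n).step i).carrier a) (hy : y ∈ ((D.filt m).pred j).carrier b) :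
    D.comp h k hd x y ∈ ((D.filt p).pred l).carrier c := by
  cases j with
  | zero =>
    rw [(AddSubgroup.mem_bot.1 hy : y = 0), map_zero]
    exact zero_mem _
  | succ j =>
    obtain rfl : i + j + 1 = l := by omega
    exact D.comp_mem h k hd i j x y hx hy

lemma comp_mem_rel {n m p : ℕ} (h : p + 1 = n + m) (k : Fin n) {a b c : ℕ}
    (hd : a + b = c) {x : (D.obj n).X a} {y : (D.obj m).X b}
    (hx : x ∈ (D.filt n).rel a) (hy : y ∈ (D.filt m).rel b) :
    D.comp h k hd x y ∈ (D.filt p).rel c := by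
  refine ⟨?_, fun e => D.d_comp_mem h k hd x y _ ?_ ?_⟩
  · subst hd
    exact D.comp_mem h k rfl a b x y hx.1 hy.1
  · intro a' hd'
    exact D.comp_mem_pred_left h k hd' hd (hx.2 a') hy.1
  · intro b' hd'
    exact D.comp_mem_pred_right h k hd' hd hx.1 (hy.2 b')

/-- The composition restricted to the relative cycles, followed by the class map. -/
def preComp {n m p : ℕ} (h : p + 1 = n + m) (k : Fin n) {a b c : ℕ} (hd : a + b = c) :
    (D.filt n).rel a →+ (D.filt m).rel b →+ (D.filt p).condensation.X c :=
  AddMonoidHom.mk' (fun x => AddMonoidHom.mk' (fun y =>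
      (D.filt p).cls c ⟨D.comp h k hd x.1 y.1, D.comp_mem_rel h k hd x.2 y.2⟩)
    (fun y y' => by
      rw [← map_add]
      exact congrArg ((D.filt p).cls c) (Subtype.ext (map_add (D.comp h k hd x.1) y.1 y'.1))))
    (fun x x' => AddMonoidHom.ext fun y => by
      refine Eq.trans ?_ (map_add ((D.filt p).cls c) _ _)
      exact congrArg ((D.filt p).cls c) (Subtype.ext
        (congrArg (fun ψ => ψ y.1) (map_add (D.comp h k hd) x.1 x'.1))))

lemma preComp_eq_zero_left {n m p : ℕ} (h : p + 1 = n + m) (k : Fin n) {a b c : ℕ}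
    (hd : a + b = c) (x : (D.filt n).rel a) (hx : (D.filt n).cls a x = 0)
    (y : (D.filt m).rel b) : D.preComp h k hd x y = 0 := by
  obtain ⟨u, hu, hxu⟩ := ((D.filt n).cls_eq_zero_iff a x).1 hx
  refine ((D.filt p).cls_eq_zero_iff c _).2
    ⟨D.comp h k (by omega : a + 1 + b = c + 1) u y.1, ?_, ?_⟩
  · subst hd
    exact D.comp_mem h k _ a b _ _ hu y.2.1
  · have h1 := D.comp_mem_pred_left h k hd hd hxu y.2.1
    rw [map_sub, AddMonoidHom.sub_apply] at h1
    rcases b with _ | b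
    · rw [D.d_comp_zero_right]; exact h1
    · rw [D.d_comp, ← sub_sub]
      exact sub_mem h1 (zsmul_mem (D.comp_mem_pred_right h k _ hd hu (y.2.2 b)) _)

lemma preComp_eq_zero_right {n m p : ℕ} (h : p + 1 = n + m) (k : Fin n) {a b c : ℕ}
    (hd : a + b = c) (y : (D.filt m).rel b) (hy : (D.filt m).cls b y = 0)
    (x : (D.filt n).rel a) : D.preComp h k hd x y = 0 := by
  obtain ⟨u, hu, hyu⟩ := ((D.filt m).cls_eq_zero_iff b y).1 hy
  refine ((D.filt p).cls_eq_zero_iff c _).2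
    ⟨(-1 : ℤ) ^ a • D.comp h k (by omega : a + (b + 1) = c + 1) x.1 u, ?_, ?_⟩
  · subst hd
    exact zsmul_mem (D.comp_mem h k _ a b _ _ x.2.1 hu) _
  · have h1 := D.comp_mem_pred_right h k hd hd x.2.1 hyu
    rw [map_sub] at h1
    rcases a with _ | a
    · rw [pow_zero, one_smul, D.d_comp_zero_left]; exact h1
    · have hs : (-1 : ℤ) ^ (a + 1) * (-1 : ℤ) ^ (a + 1) = 1 := by
        rw [← mul_pow, neg_one_mul, neg_neg, one_pow]
      rw [map_zsmul, D.d_comp, smul_add, smul_smul, hs, one_smul, sub_add_eq_sub_sub_swap]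
      exact sub_mem h1 (zsmul_mem (D.comp_mem_pred_left h k _ hd (x.2.2 a) hu) _)

/-- The composition of the condensation: `[x] ∘_k [y] = [x ∘_k y]`. -/
def condensationComp {n m p : ℕ} (h : p + 1 = n + m) (k : Fin n) {a b c : ℕ}
    (hd : a + b = c) :
    (D.filt n).condensation.X a →+ (D.filt m).condensation.X b →+
      (D.filt p).condensation.X c :=
  liftBiadd ((D.filt n).cls a) ((D.filt n).cls_surjective a) ((D.filt m).cls b)
    ((D.filt m).cls_surjective b) (D.preComp h k hd) (D.preComp_eq_zero_left h k hd)
    (D.preComp_eq_zero_right h k hd)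

lemma condensationComp_cls {n m p : ℕ} (h : p + 1 = n + m) (k : Fin n) {a b c : ℕ}
    (hd : a + b = c) (x : (D.filt n).rel a) (y : (D.filt m).rel b) :
    D.condensationComp h k hd ((D.filt n).cls a x) ((D.filt m).cls b y) =
      (D.filt p).cls c ⟨D.comp h k hd x.1 y.1, D.comp_mem_rel h k hd x.2 y.2⟩ :=
  liftBiadd_apply _ _ _ _ _ _ _ x y

lemma one_mem_rel : D.one ∈ (D.filt 1).rel 0 :=
  ⟨D.one_mem, fun b => by
    rw [(D.obj 1).shape 0 b (by simp)]; exact zero_mem _⟩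

/-- The condensation of a filtered chain operad: its `n`-th object is the condensation of `D(n)`,
with the operad structure induced by that of `D`. -/
def condensation : ChainOperad.{u} where
  obj n := (D.filt n).condensation
  act n σ := ChainFiltration.condensationMap (D.act n σ) (D.act_mem n σ)
  act_one n := by
    ext a z
    obtain ⟨x, rfl⟩ := (D.filt n).cls_surjective a z
    refine (ChainFiltration.condensationMap_cls _ _ a x).trans ?_
    exact congrArg ((D.filt n).cls a) (Subtype.ext (by
      change (D.act n 1).f a x.1 = x.1
      rw [D.act_one]; rfl))
  act_mul n σ τ := by
    ext a z
    obtain ⟨x, rfl⟩ := (D.filt n).cls_surjective a z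
    refine (ChainFiltration.condensationMap_cls _ _ a x).trans (Eq.trans ?_
      ((congrArg _ (ChainFiltration.condensationMap_cls _ _ a x)).trans
        (ChainFiltration.condensationMap_cls _ _ a _)).symm)
    exact congrArg ((D.filt n).cls a) (Subtype.ext (by
      change (D.act n (σ * τ)).f a x.1 = (D.act n σ).f a ((D.act n τ).f a x.1)
      rw [D.act_mul]; rfl))
  one := (D.filt 1).cls 0 ⟨D.one, D.one_mem_rel⟩
  comp h k _ _ _ hd := D.condensationComp h k hd
  d_comp {n m p} h k {a b c} hd z w := by
    obtain ⟨x, rfl⟩ := (D.filt n).cls_surjective _ z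
    obtain ⟨y, rfl⟩ := (D.filt m).cls_surjective _ w
    rw [condensationComp_cls, ChainFiltration.d_cls, ChainFiltration.d_cls,
      ChainFiltration.d_cls, condensationComp_cls, condensationComp_cls, ← map_zsmul, ← map_add]
    exact congrArg ((D.filt p).cls c) (Subtype.ext (D.d_comp h k hd x.1 y.1))
  d_comp_zero_left {n m p} h k {b c} hd z w := by
    obtain ⟨x, rfl⟩ := (D.filt n).cls_surjective _ z
    obtain ⟨y, rfl⟩ := (D.filt m).cls_surjective _ w
    rw [condensationComp_cls, ChainFiltration.d_cls, ChainFiltration.d_cls, condensationComp_cls]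
    exact congrArg ((D.filt p).cls c) (Subtype.ext (D.d_comp_zero_left h k hd x.1 y.1))
  d_comp_zero_right {n m p} h k {a c} hd z w := by
    obtain ⟨x, rfl⟩ := (D.filt n).cls_surjective _ z
    obtain ⟨y, rfl⟩ := (D.filt m).cls_surjective _ w
    rw [condensationComp_cls, ChainFiltration.d_cls, ChainFiltration.d_cls, condensationComp_cls]
    exact congrArg ((D.filt p).cls c) (Subtype.ext (D.d_comp_zero_right h k hd x.1 y.1))
  one_comp {m} h {b} hd w := by
    obtain ⟨y, rfl⟩ := (D.filt m).cls_surjective _ w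
    rw [condensationComp_cls]
    exact congrArg ((D.filt m).cls b) (Subtype.ext (D.one_comp h hd y.1))
  comp_one {n} h k {a} hd z := by
    obtain ⟨x, rfl⟩ := (D.filt n).cls_surjective _ z
    rw [condensationComp_cls]
    exact congrArg ((D.filt n).cls a) (Subtype.ext (D.comp_one h k hd x.1))
  assoc {n m l p q r} h₁ h₂ h₃ h₄ i j {a b c ab bc abc} hab hbc habc habc' z w v := by
    obtain ⟨x, rfl⟩ := (D.filt n).cls_surjective _ z
    obtain ⟨y, rfl⟩ := (D.filt m).cls_surjective _ w
    obtain ⟨t, rfl⟩ := (D.filt l).cls_surjective _ v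
    rw [condensationComp_cls, condensationComp_cls, condensationComp_cls, condensationComp_cls]
    exact congrArg ((D.filt q).cls abc)
      (Subtype.ext (D.assoc h₁ h₂ h₃ h₄ i j hab hbc habc habc' x.1 y.1 t.1))
  assoc_parallel {n m l p q r} h₁ h₂ h₃ h₄ i k hik {a b c ab ac abc} hab hac habc hacb z w v := by
    obtain ⟨x, rfl⟩ := (D.filt n).cls_surjective _ z
    obtain ⟨y, rfl⟩ := (D.filt m).cls_surjective _ w
    obtain ⟨t, rfl⟩ := (D.filt l).cls_surjective _ v
    rw [condensationComp_cls, condensationComp_cls, condensationComp_cls, condensationComp_cls,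
      ← map_zsmul]
    exact congrArg ((D.filt q).cls abc)
      (Subtype.ext (D.assoc_parallel h₁ h₂ h₃ h₄ i k hik hab hac habc hacb x.1 y.1 t.1))
  act_comp {n m p} h k {a b c} hd σ τ ρ hρ z w := by
    obtain ⟨x, rfl⟩ := (D.filt n).cls_surjective _ z
    obtain ⟨y, rfl⟩ := (D.filt m).cls_surjective _ w
    rw [ChainFiltration.condensationMap_cls, ChainFiltration.condensationMap_cls,
      condensationComp_cls, condensationComp_cls, ChainFiltration.condensationMap_cls]
    exact congrArg ((D.filt p).cls c) (Subtype.ext (D.act_comp h k hd σ τ ρ hρ x.1 y.1))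

end FilteredChainOperad

end

/-!
Let `E(n)_a ⊆ D(n)_a` consist of the chains `x ∈ F_a D(n)_a` with `d x ∈ F_{a-1} D(n)`. These groups
form a suboperad `E` of `D`, because compositions add both degrees and filtrations, and both
the inclusion `E → D` and the class map `E → condensation of D`, `x ↦ [x]`, are morphisms of chain
operads. Both are quasi-isomorphisms, by descent along the filtration: since
`H_a (F_i / F_{i-1}) = 0` for `i ≠ a`, a chain of `F_i` in degree `a` with boundary in `F_{i-1}` can
be moved into `F_{i-1}` by subtracting a boundary of `F_i`.

* For `E → D`, the descent from any filtration down to `F_a` replaces a cycle of degree `a` by a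
  homologous cycle of `F_a`, and a chain of degree `a` with boundary in `E` by one in `F_a` with
  the same boundary (`exists_sub_d_mem_step`).
* For `E → condensation`, which is surjective, it suffices that the kernel is acyclic. A cycle of
  degree `a` in the kernel is, up to the boundary of a chain of `F_a`, a cycle of `F_{a-1}`; the
  descent then goes on to `F_{-1} = 0`, so this cycle is a boundary (`exists_eq_d_of_mem_pred`).
-/

open SubChain

/-! ### Quasi-isomorphisms of complexes of abelian groups, in terms of elements -/

lemma exists_iCycles_eq {K : ChainComplex AddCommGrpCat.{u} ℕ} {a : ℕ} {x : K.X a}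
    (hx : ∀ b, K.d a b x = 0) : ∃ z : K.cycles a, K.iCycles a z = x :=
  (ShortComplex.ab_exact_iff _).1 (ShortComplex.exact_of_f_is_kernel
    (ShortComplex.mk _ _ (K.iCycles_d a ((ComplexShape.down ℕ).next a)))
    (K.cyclesIsKernel a _ rfl)) x (hx _)

lemma d_iCycles_apply {K : ChainComplex AddCommGrpCat.{u} ℕ} {a : ℕ} (z : K.cycles a) (b : ℕ) :
    K.d a b (K.iCycles a z) = 0 := by
  rw [← ConcreteCategory.comp_apply, HomologicalComplex.iCycles_d]; rfl

lemma homologyπ_eq_zero_iff {K : ChainComplex AddCommGrpCat.{u} ℕ} {a : ℕ} (z : K.cycles a) :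
    K.homologyπ a z = 0 ↔ ∃ y, K.d (a + 1) a y = K.iCycles a z := by
  have hS : (ShortComplex.mk _ _ (K.toCycles_comp_homologyπ (a + 1) a)).Exact :=
    ShortComplex.exact_of_g_is_cokernel _ (K.homologyIsCokernel (a + 1) a (by simp))
  have e : ∀ y, K.iCycles a (K.toCycles (a + 1) a y) = K.d (a + 1) a y := fun y => by
    rw [← ConcreteCategory.comp_apply, HomologicalComplex.toCycles_i]
  constructor
  · intro h
    obtain ⟨y, hy⟩ := (ShortComplex.ab_exact_iff _).1 hS _ h
    exact ⟨y, (e y).symm.trans (congrArg (K.iCycles a) hy)⟩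
  · rintro ⟨y, hy⟩
    rw [← iCycles_injective K a ((e y).trans hy), ← ConcreteCategory.comp_apply,
      HomologicalComplex.toCycles_comp_homologyπ]
    rfl

lemma quasiIso_of_elements {K L : ChainComplex AddCommGrpCat.{u} ℕ} (f : K ⟶ L)
    (hsurj : ∀ (a : ℕ) (y : L.X a), (∀ b, L.d a b y = 0) →
      ∃ x : K.X a, (∀ b, K.d a b x = 0) ∧ ∃ w, L.d (a + 1) a w = y - f.f a x)
    (hinj : ∀ (a : ℕ) (x : K.X a), (∀ b, K.d a b x = 0) →
      (∃ w, L.d (a + 1) a w = f.f a x) → ∃ v, K.d (a + 1) a v = x) : QuasiIso f := by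
  have hπ : ∀ (M : ChainComplex AddCommGrpCat.{u} ℕ) (a : ℕ),
      Function.Surjective (M.homologyπ a) := fun M a =>
    (AddCommGrpCat.epi_iff_surjective _).1 inferInstance
  have hmap : ∀ (a : ℕ) (z : K.cycles a), HomologicalComplex.homologyMap f a (K.homologyπ a z) =
      L.homologyπ a (HomologicalComplex.cyclesMap f a z) := fun a z => by
    rw [← ConcreteCategory.comp_apply, HomologicalComplex.homologyπ_naturality,
      ConcreteCategory.comp_apply]
  have hi : ∀ (a : ℕ) (z : K.cycles a), L.iCycles a (HomologicalComplex.cyclesMap f a z) =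
      f.f a (K.iCycles a z) := fun a z => by
    rw [← ConcreteCategory.comp_apply, HomologicalComplex.cyclesMap_i,
      ConcreteCategory.comp_apply]
  refine ⟨fun a => ?_⟩
  rw [quasiIsoAt_iff_isIso_homologyMap, ConcreteCategory.isIso_iff_bijective]
  refine ⟨(injective_iff_map_eq_zero _).2 fun c hc => ?_, fun c => ?_⟩
  · obtain ⟨z, rfl⟩ := hπ K a c
    rw [hmap, homologyπ_eq_zero_iff, hi] at hc
    exact (homologyπ_eq_zero_iff z).2 (hinj a _ (d_iCycles_apply z) hc)
  · obtain ⟨z, rfl⟩ := hπ L a c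
    obtain ⟨x, hx, w, hw⟩ := hsurj a _ (d_iCycles_apply z)
    obtain ⟨t, rfl⟩ := exists_iCycles_eq hx
    refine ⟨K.homologyπ a t, ?_⟩
    rw [hmap, eq_comm, ← sub_eq_zero, ← map_sub, homologyπ_eq_zero_iff]
    exact ⟨w, by rw [hw, map_sub, hi]⟩

/-- A degreewise surjective chain map with acyclic kernel is a quasi-isomorphism. -/
lemma quasiIso_of_surjective {K L : ChainComplex AddCommGrpCat.{u} ℕ} (f : K ⟶ L)
    (hf : ∀ a, Function.Surjective (f.f a))
    (hker : ∀ (a : ℕ) (x : K.X a), (∀ b, K.d a b x = 0) → f.f a x = 0 →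
      ∃ v, f.f (a + 1) v = 0 ∧ K.d (a + 1) a v = x) : QuasiIso f := by
  have hcomm : ∀ (a b : ℕ) (x : K.X a), L.d a b (f.f a x) = f.f b (K.d a b x) := fun a b x => by
    rw [← ConcreteCategory.comp_apply, ← ConcreteCategory.comp_apply, f.comm]
  have hdd : ∀ (a b c : ℕ) (x : K.X a), K.d b c (K.d a b x) = 0 := fun a b c x => by
    rw [← ConcreteCategory.comp_apply, K.d_comp_d]; rfl
  refine quasiIso_of_elements f (fun a y hy => ?_) (fun a x hx => ?_)
  · obtain ⟨x, rfl⟩ := hf a y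
    rcases a with _ | a
    · refine ⟨x, fun b => ?_, 0, by rw [map_zero, sub_self]⟩
      rw [K.shape 0 b (by simp)]; rfl
    · obtain ⟨v, hv, hvx⟩ := hker a (K.d (a + 1) a x) (fun b => hdd _ _ b _)
        (by rw [← hcomm]; exact hy a)
      refine ⟨x - v, fun b => ?_, 0, by rw [map_zero, map_sub, hv, sub_zero, sub_self]⟩
      by_cases hb : b = a
      · subst hb
        rw [map_sub, hvx, sub_self]
      · rw [K.shape (a + 1) b (by simp; omega)]; rfl
  · rintro ⟨w, hw⟩
    obtain ⟨w, rfl⟩ := hf _ w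
    obtain ⟨v, -, hv⟩ := hker a (x - K.d (a + 1) a w)
      (fun b => by rw [map_sub, hx, hdd, sub_zero]) (by rw [map_sub, ← hcomm, hw, sub_self])
    exact ⟨w + v, by rw [map_add, hv, add_sub_cancel]⟩

/-! ### Subcomplexes and suboperads -/

namespace SubChain

variable {X : ChainComplex AddCommGrpCat.{u} ℕ}

/-- A subcomplex as a chain complex. -/
def toComplex (P : SubChain X) : ChainComplex AddCommGrpCat.{u} ℕ where
  X a := AddCommGrpCat.of (P.carrier a)
  d a b := AddCommGrpCat.ofHom (P.dHom a b)
  shape a b h := by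
    ext x
    change X.d a b x.1 = 0
    rw [X.shape a b h]; rfl
  d_comp_d' a b c _ _ := by
    ext x
    change X.d b c (X.d a b x.1) = 0
    rw [← ConcreteCategory.comp_apply, X.d_comp_d]; rfl

/-- The inclusion of a subcomplex. -/
def ι (P : SubChain X) : P.toComplex ⟶ X where
  f a := AddCommGrpCat.ofHom (P.carrier a).subtype
  comm' _ _ _ := rfl

/-- The restriction of an endomorphism of `X` to a subcomplex that it preserves. -/
def restrict (P : SubChain X) (f : X ⟶ X)
    (hf : ∀ a x, x ∈ P.carrier a → f.f a x ∈ P.carrier a) : P.toComplex ⟶ P.toComplex where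
  f a := AddCommGrpCat.ofHom (((f.f a).hom.comp (P.carrier a).subtype).codRestrict (P.carrier a)
    (fun x => hf a x x.2))
  comm' a b _ := by
    ext x
    refine Subtype.ext ?_
    change X.d a b (f.f a x.1) = f.f b (X.d a b x.1)
    rw [← ConcreteCategory.comp_apply, ← ConcreteCategory.comp_apply, f.comm]

end SubChain

namespace ChainOperad

/-- Subcomplexes of the objects of a chain operad that are stable under the operad structure. -/
structure SubOperad (D : ChainOperad.{u}) where
  sub (n : ℕ) : SubChain (D.obj n)
  act_mem (n : ℕ) (σ : Equiv.Perm (Fin n)) (a : ℕ) (x : (D.obj n).X a)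
    (hx : x ∈ (sub n).carrier a) : (D.act n σ).f a x ∈ (sub n).carrier a
  one_mem : D.one ∈ (sub 1).carrier 0
  comp_mem {n m p : ℕ} (h : p + 1 = n + m) (k : Fin n) {a b c : ℕ} (hd : a + b = c)
    (x : (D.obj n).X a) (y : (D.obj m).X b) (hx : x ∈ (sub n).carrier a)
    (hy : y ∈ (sub m).carrier b) : D.comp h k hd x y ∈ (sub p).carrier c

namespace SubOperad

variable {D : ChainOperad.{u}} (S : SubOperad D)

/-- The restriction of a composition of the operad to a suboperad. -/
def subComp {n m p : ℕ} (h : p + 1 = n + m) (k : Fin n) {a b c : ℕ} (hd : a + b = c) :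
    (S.sub n).carrier a →+ (S.sub m).carrier b →+ (S.sub p).carrier c :=
  AddMonoidHom.mk' (fun x => AddMonoidHom.mk' (fun y =>
      ⟨D.comp h k hd x.1 y.1, S.comp_mem h k hd _ _ x.2 y.2⟩)
    (fun y y' => Subtype.ext (map_add (D.comp h k hd x.1) y.1 y'.1)))
    (fun x x' => AddMonoidHom.ext fun y => Subtype.ext
      (congrArg (fun ψ => ψ y.1) (map_add (D.comp h k hd) x.1 x'.1)))

/-- A suboperad as a chain operad. -/
def toOperad : ChainOperad.{u} where
  obj n := (S.sub n).toComplex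
  act n σ := (S.sub n).restrict (D.act n σ) (S.act_mem n σ)
  act_one n := by
    ext a x
    refine Subtype.ext ?_
    change (D.act n 1).f a x.1 = x.1
    rw [D.act_one]; rfl
  act_mul n σ τ := by
    ext a x
    refine Subtype.ext ?_
    change (D.act n (σ * τ)).f a x.1 = (D.act n σ).f a ((D.act n τ).f a x.1)
    rw [D.act_mul]; rfl
  one := ⟨D.one, S.one_mem⟩
  comp h k _ _ _ hd := S.subComp h k hd
  d_comp h k _ _ _ hd x y := Subtype.ext (D.d_comp h k hd x.1 y.1)
  d_comp_zero_left h k _ _ hd x y := Subtype.ext (D.d_comp_zero_left h k hd x.1 y.1)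
  d_comp_zero_right h k _ _ hd x y := Subtype.ext (D.d_comp_zero_right h k hd x.1 y.1)
  one_comp h _ hd y := Subtype.ext (D.one_comp h hd y.1)
  comp_one h k _ hd x := Subtype.ext (D.comp_one h k hd x.1)
  assoc h₁ h₂ h₃ h₄ i j _ _ _ _ _ _ hab hbc habc habc' x y z :=
    Subtype.ext (D.assoc h₁ h₂ h₃ h₄ i j hab hbc habc habc' x.1 y.1 z.1)
  assoc_parallel h₁ h₂ h₃ h₄ i k hik _ _ _ _ _ _ hab hac habc hacb x y z :=
    Subtype.ext (D.assoc_parallel h₁ h₂ h₃ h₄ i k hik hab hac habc hacb x.1 y.1 z.1)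
  act_comp h k _ _ _ hd σ τ ρ hρ x y := Subtype.ext (D.act_comp h k hd σ τ ρ hρ x.1 y.1)

/-- The inclusion of a suboperad. -/
def incl : Hom S.toOperad D where
  map n := (S.sub n).ι
  map_act _ _ := rfl
  map_one := rfl
  map_comp _ _ _ _ _ _ _ _ := rfl

end SubOperad

end ChainOperad

/-! ### Descent along a homological filtration -/

namespace ChainFiltration

variable {X : ChainComplex AddCommGrpCat.{u} ℕ} {F : ChainFiltration X}

lemma IsHomological.exists_sub_d_mem_pred (hF : F.IsHomological) {i a : ℕ} (hai : a ≠ i)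
    {x : X.X a} (hx : x ∈ (F.step i).carrier a) (hdx : ∀ b, X.d a b x ∈ (F.pred i).carrier b) :
    ∃ y ∈ (F.step i).carrier (a + 1), x - X.d (a + 1) a y ∈ (F.pred i).carrier a := by
  have := AddCommGrpCat.subsingleton_of_isZero (hF i a hai)
  exact (SubChain.cls_eq_zero_iff (F.step i) (F.pred i) a ⟨x, hx, hdx⟩).1
    (Subsingleton.elim (α := (F.gr i).homology a) _ _)

lemma d_sub_d {a : ℕ} (x : X.X a) (y : X.X (a + 1)) (b : ℕ) :
    X.d a b (x - X.d (a + 1) a y) = X.d a b x := by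
  rw [map_sub, ← ConcreteCategory.comp_apply (X.d (a + 1) a), X.d_comp_d]
  exact sub_zero _

lemma step_mono : Monotone fun i => (F.step i).carrier :=
  monotone_nat_of_le_succ F.mono

/-- A chain of degree `a` with boundary in `F_a` can be moved into `F_a` by subtracting a
boundary. -/
lemma IsHomological.exists_sub_d_mem_step (hF : F.IsHomological) {a : ℕ} (x : X.X a)
    (hdx : ∀ b, X.d a b x ∈ (F.step a).carrier b) :
    ∃ y, x - X.d (a + 1) a y ∈ (F.step a).carrier a := by
  have key : ∀ (m : ℕ) (x : X.X a), (∀ b, X.d a b x ∈ (F.step a).carrier b) →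
      x ∈ (F.step (a + m)).carrier a → ∃ y, x - X.d (a + 1) a y ∈ (F.step a).carrier a := by
    intro m
    induction m with
    | zero => exact fun x _ hx => ⟨0, by rw [map_zero, sub_zero]; exact hx⟩
    | succ m ih =>
      intro x hdx hx
      obtain ⟨y, -, hy⟩ := hF.exists_sub_d_mem_pred (i := a + m + 1) (by omega) hx
        (fun b => step_mono (Nat.le_add_right a m) b (hdx b))
      obtain ⟨z, hz⟩ := ih _ (fun b => by rw [d_sub_d]; exact hdx b) hy
      exact ⟨y + z, by rw [map_add, ← sub_sub]; exact hz⟩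
  obtain ⟨i, hi⟩ := F.exhaustive a x
  exact key i x hdx (step_mono (Nat.le_add_left i a) a hi)

/-- A cycle of `F_{i-1}` of degree at least `i` is the boundary of a chain of `F_{i-1}`. -/
lemma IsHomological.exists_eq_d_of_mem_pred (hF : F.IsHomological) {i a : ℕ} (hia : i ≤ a)
    {x : X.X a} (hx : x ∈ (F.pred i).carrier a) (hdx : ∀ b, X.d a b x = 0) :
    ∃ y ∈ (F.pred i).carrier (a + 1), X.d (a + 1) a y = x := by
  induction i generalizing x with
  | zero =>
    rw [(AddSubgroup.mem_bot.1 hx : x = 0)]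
    exact ⟨0, zero_mem _, map_zero _⟩
  | succ i ih =>
    obtain ⟨y, hy, hxy⟩ := hF.exists_sub_d_mem_pred (i := i) (by omega) hx
      (fun b => by rw [hdx]; exact zero_mem _)
    obtain ⟨z, hz, hzx⟩ := ih (by omega) hxy (fun b => by rw [d_sub_d, hdx])
    exact ⟨y + z, add_mem hy (F.pred_le i _ hz), by rw [map_add, hzx, add_sub_cancel]⟩

/-! ### The two quasi-isomorphisms -/

variable (F)

/-- The subcomplex of the chains `x ∈ F_a X_a`, `a ≥ 0`, with `d x ∈ F_{a-1}`. -/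
def relSub : SubChain X where
  carrier := F.rel
  d_mem _ _ _ hx := F.d_mem_rel hx

/-- The class map from the chains `x ∈ F_a X_a` with `d x ∈ F_{a-1}` to the condensation. -/
noncomputable def clsMap : F.relSub.toComplex ⟶ F.condensation where
  f a := AddCommGrpCat.ofHom (F.cls a)
  comm' a b _ := by
    ext x
    exact F.d_cls a b x

variable {F}

lemma IsHomological.quasiIso_ι (hF : F.IsHomological) : QuasiIso F.relSub.ι := by
  refine quasiIso_of_elements _ (fun a y hy => ?_) ?_
  · obtain ⟨w, hw⟩ := hF.exists_sub_d_mem_step y (fun b => by rw [hy]; exact zero_mem _)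
    have hd : ∀ b, X.d a b (y - X.d (a + 1) a w) = 0 := fun b => by rw [d_sub_d, hy]
    exact ⟨⟨_, hw, fun b => by rw [hd]; exact zero_mem _⟩, fun b => Subtype.ext (hd b), w,
      (sub_sub_cancel y _).symm⟩
  · rintro a x - ⟨w, hw⟩
    replace hw : X.d (a + 1) a w = x.1 := hw
    have hdw : ∀ b, X.d (a + 1) b w ∈ (F.step a).carrier b := fun b => by
      by_cases hb : b = a
      · subst hb
        rw [hw]; exact x.2.1
      · rw [X.shape (a + 1) b (by simp; omega)]; exact zero_mem _
    obtain ⟨v, hv⟩ := hF.exists_sub_d_mem_step w (fun b => F.mono a b (hdw b))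
    exact ⟨⟨_, hv, fun b => by rw [d_sub_d]; exact hdw b⟩,
      Subtype.ext ((d_sub_d w v a).trans hw)⟩

lemma IsHomological.quasiIso_clsMap (hF : F.IsHomological) : QuasiIso F.clsMap := by
  refine quasiIso_of_surjective _ F.cls_surjective (fun a x hx hx0 => ?_)
  have hd : ∀ b, X.d a b x.1 = 0 := fun b => congrArg Subtype.val (hx b)
  obtain ⟨y, hy, hxy⟩ := (F.cls_eq_zero_iff a x).1 hx0
  obtain ⟨v, hv, hvx⟩ := hF.exists_eq_d_of_mem_pred le_rfl hxy
    (fun b => by rw [d_sub_d, hd])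
  have hmem : y + v ∈ (F.step a).carrier (a + 1) := add_mem hy (F.pred_le a _ hv)
  have hdx : X.d (a + 1) a (y + v) = x.1 := by rw [map_add, hvx, add_sub_cancel]
  have hrel : y + v ∈ F.rel (a + 1) := ⟨F.mono a _ hmem, fun b => (F.step a).d_mem _ _ _ hmem⟩
  -- The class of `y + v` vanishes since `y + v` lies in `F_a`, one step below its degree.
  refine ⟨⟨y + v, hrel⟩, (F.cls_eq_zero_iff (a + 1) ⟨_, hrel⟩).2 ⟨0, zero_mem _, ?_⟩,
    Subtype.ext hdx⟩
  rw [map_zero, sub_zero]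
  exact hmem

end ChainFiltration

namespace FilteredChainOperad

variable (D : FilteredChainOperad.{u})

/-- The suboperad of `D` of the chains `x ∈ F_a D(n)_a` with `d x ∈ F_{a-1} D(n)`. -/
def relOperad : ChainOperad.SubOperad D.toChainOperad where
  sub n := (D.filt n).relSub
  act_mem n σ _ _ hx := ChainFiltration.map_mem_rel (D.act n σ) (D.act_mem n σ) hx
  one_mem := D.one_mem_rel
  comp_mem h k _ _ _ hd _ _ hx hy := D.comp_mem_rel h k hd hx hy

/-- The class map, as a morphism of operads to the condensation. -/
noncomputable def clsHom : ChainOperad.Hom D.relOperad.toOperad D.condensation where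
  map n := (D.filt n).clsMap
  map_act n σ := by
    ext a x
    exact (ChainFiltration.condensationMap_cls (D.act n σ) (D.act_mem n σ) a x).symm
  map_one := rfl
  map_comp h k _ _ _ hd x y := (D.condensationComp_cls h k hd x y).symm

end FilteredChainOperad

theorem theorem6p1 (D : FilteredChainOperad.{u}) (hD : D.IsHomological) :
    ChainOperad.QuasiIsomorphic D.toChainOperad D.condensation :=
  ⟨D.relOperad.toOperad, D.relOperad.incl, D.clsHom, fun n => (hD n).quasiIso_ι,
    fun n => (hD n).quasiIso_clsMap⟩
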